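/- Let $p$ be a prime, let $T\in\mathbb{Z}_p[z]$ be a polynomial, regarded as a continuous map $T:\mathbb{Z}_p\to\mathbb{Z}_p$ on the ring of $p$-adic integers, and let $T^m$ denote its $m$-fold composition with itself ($T^0=\mathrm{id}$). Let $\ell\ge 1$ be an integer, let $q_1,\dots,q_\ell\in\mathbb{Q}[z]$ be polynomials with $q_j(n)\in\mathbb{N}=\{0,1,2,\dots\}$ for all $1\le j\le\ell$ and all integers $n\ge 0$, and put $\Delta:=\max_{1\le j\le\ell}\deg q_j$ (with $\deg 0:=0$). Let $(c_n)_{n\ge 0}$ be a sequence of complex numbers that is oscillating of order $\Delta$, i.e. $$\lim_{N\to\infty}\frac1N\sum_{n=0}^{N-1}c_n e^{2\pi i P(n)}=0\quad\text{for every real polynomial } P \text{ of degree at most } \Delta,$$ and suppose that $\sum_{n=1}^{N}|c_n|=O(N)$ as $N\to\infty$. Then for every continuous function $F:\mathbb{Z}_p^\ell\to\mathbb{C}$ and every $x\in\mathbb{Z}_p$, $$\lim_{N\to\infty}\frac1N\sum_{n=0}^{N-1}c_n F\bigl(T^{q_1(n)}x,\dots,T^{q_\ell(n)}x\bigr)=0.$$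 -/

import Mathlib

open Filter Topology Asymptotics

/-- A sequence `(c n)` of complex numbers, `n ≥ 0`, is oscillating of order `d` if
`(1 / N) ∑_{0 ≤ n < N} c n * e ^ (2 π i P(n))` tends to `0` for every real polynomial `P` of degree
at most `d`.  (For `d = 0` the condition says that the means of `(c n)` tend to `0`.) -/
def IsOscillating (d : ℕ) (c : ℕ → ℂ) : Prop :=
  ∀ P : Polynomial ℝ, P.natDegree ≤ d →
    Tendsto (fun N : ℕ => (1 / (N : ℂ)) *
      ∑ n ∈ Finset.range N,
        c n * Complex.exp (2 * (Real.pi : ℂ) * Complex.I * ((P.eval (n : ℝ) : ℝ) : ℂ)))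
      atTop (𝓝 0)

/-! Modulo `p ^ m` the polynomial `T` acts on a finite ring, so orbits are eventually periodic
there. Integer-valued polynomials are periodic modulo every integer, so the sampled orbits stay
eventually periodic. Such a sequence is, up to finitely many terms, a combination of exponentials
with linear phase, hence orthogonal to `c` once `Δ ≥ 1`. Uniform continuity of `F` on a compact
space and the bound on the means of `‖c n‖` carry this to the limit. For `Δ = 0` every `q j` is
constant. -/

/-- The means of `c` against `a`. -/
noncomputable def weightedMean (c a : ℕ → ℂ) (N : ℕ) : ℂ :=
  (1 / (N : ℂ)) * ∑ n ∈ Finset.range N, c n * a n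

/-- A sequence is eventually periodic if it is periodic from some index on. -/
def EventuallyPeriodic {α : Type*} (a : ℕ → α) : Prop :=
  ∃ M : ℕ, 0 < M ∧ ∀ᶠ n in atTop, a (n + M) = a n

theorem EventuallyPeriodic.comp {α β : Type*} {a : ℕ → α} (ha : EventuallyPeriodic a)
    (f : α → β) : EventuallyPeriodic (fun n => f (a n)) := by
  obtain ⟨M, hM, h⟩ := ha
  exact ⟨M, hM, h.mono fun n hn => by simp only [hn]⟩

theorem eventually_add_mul_eq {α : Type*} {a : ℕ → α} {M : ℕ}
    (h : ∀ᶠ n in atTop, a (n + M) = a n) (t : ℕ) : ∀ᶠ n in atTop, a (n + M * t) = a n := by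
  induction t with
  | zero => simp
  | succ t ih =>
    filter_upwards [ih, (tendsto_add_atTop_nat (M * t)).eventually h] with n h1 h2
    rw [Nat.mul_succ, ← Nat.add_assoc, h2, h1]

theorem EventuallyPeriodic.pi {ι : Type*} [Fintype ι] {α : Type*} {a : ι → ℕ → α}
    (ha : ∀ i, EventuallyPeriodic (a i)) : EventuallyPeriodic (fun n i => a i n) := by
  choose M hM h using ha
  refine ⟨∏ i, M i, Finset.prod_pos fun i _ => hM i, ?_⟩
  have key : ∀ i, ∀ᶠ n in atTop, a i (n + ∏ j, M j) = a i n := fun i => by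
    obtain ⟨t, ht⟩ := Finset.dvd_prod_of_mem M (Finset.mem_univ i)
    rw [ht]
    exact eventually_add_mul_eq (h i) t
  filter_upwards [eventually_all.2 key] with n hn
  exact funext hn

/-- Orbits of a self-map of a finite type are eventually periodic. -/
theorem eventuallyPeriodic_iterate {α : Type*} [Finite α] (f : α → α) (y : α) :
    EventuallyPeriodic (fun n => f^[n] y) := by
  obtain ⟨i, j, hij, h⟩ := Finite.exists_ne_map_eq_of_infinite (fun n : ℕ => f^[n] y)
  wlog hlt : i < j generalizing i j
  · exact this j i hij.symm h.symm (by omega)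
  refine ⟨j - i, by omega, ?_⟩
  filter_upwards [eventually_ge_atTop i] with n hn
  have h1 : n + (j - i) = (n - i) + j := by omega
  have h2 : n = (n - i) + i := by omega
  have h3 : f^[n] y = f^[(n - i) + i] y := by rw [← h2]
  rw [h3, h1, Function.iterate_add_apply, Function.iterate_add_apply]
  exact congrArg _ h.symm

/-- A polynomial with natural values at the natural numbers is periodic modulo every `d > 0`. -/
theorem exists_period_modEq (q : Polynomial ℚ) (k : ℕ → ℕ)
    (hk : ∀ n : ℕ, q.eval (n : ℚ) = (k n : ℚ)) (d : ℕ) (hd : 0 < d) :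
    ∃ M : ℕ, 0 < M ∧ ∀ n, k (n + M) ≡ k n [MOD d] := by
  obtain ⟨b, hb, hQ⟩ := IsLocalization.integerNormalization_spec (nonZeroDivisors ℤ) q
  set Q := IsLocalization.integerNormalization (nonZeroDivisors ℤ) q
  have hb0 : b ≠ 0 := nonZeroDivisors.ne_zero hb
  have hQe : ∀ n : ℕ, Q.eval (n : ℤ) = b * k n := fun n => by
    have h := congrArg (Polynomial.eval (n : ℚ)) hQ
    rw [Polynomial.eval_smul, hk] at h
    have h2 : ((Q.eval (n : ℤ) : ℤ) : ℚ) = (Q.map (algebraMap ℤ ℚ)).eval (n : ℚ) := by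
      rw [Polynomial.eval_map, ← eq_intCast (algebraMap ℤ ℚ), ← Polynomial.eval₂_at_apply]
      simp
    rw [← h2] at h
    have h3 : ((Q.eval (n : ℤ) : ℤ) : ℚ) = ((b * k n : ℤ) : ℚ) := by
      rw [h]; simp
    exact_mod_cast h3
  -- With `Q = b q` integral, a shift by `d|b|` changes `Q` by a multiple of `d b`; cancelling `b`
  -- leaves `d`.
  refine ⟨d * b.natAbs, Nat.mul_pos hd (Int.natAbs_pos.2 hb0), fun n => ?_⟩
  have h := Polynomial.sub_dvd_eval_sub ((n + d * b.natAbs : ℕ) : ℤ) (n : ℤ) Q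
  rw [hQe, hQe, ← mul_sub] at h
  have h4 : b * (d : ℤ) ∣ b * ((k (n + d * b.natAbs) : ℤ) - k n) := by
    refine dvd_trans ?_ h
    rw [show ((n + d * b.natAbs : ℕ) : ℤ) - n = d * (b.natAbs : ℤ) by push_cast; ring, mul_comm]
    exact mul_dvd_mul_left _ (Int.dvd_natAbs.2 dvd_rfl)
  exact ((Nat.modEq_iff_dvd).2 ((mul_dvd_mul_iff_left hb0).1 h4)).symm

/-- Needed since periodicity holds only past a threshold, which nonconstant exponents eventually
exceed. -/
theorem polynomial_natValues_const_or_tendsto (q : Polynomial ℚ) (k : ℕ → ℕ)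
    (hk : ∀ n : ℕ, q.eval (n : ℚ) = (k n : ℚ)) :
    (∀ n, k n = k 0) ∨ Tendsto k atTop atTop := by
  rcases Nat.eq_zero_or_pos q.natDegree with h0 | hpos
  · left
    intro n
    rw [Polynomial.eq_C_of_natDegree_eq_zero h0] at hk
    have h1 := (hk n).symm.trans ((Polynomial.eval_C).trans
      ((Polynomial.eval_C (x := ((0 : ℕ) : ℚ))).symm.trans (hk 0)))
    exact_mod_cast h1
  · right
    have h1 := (Polynomial.abs_tendsto_atTop q
      (Polynomial.natDegree_pos_iff_degree_pos.1 hpos)).comp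
      (tendsto_natCast_atTop_atTop (R := ℚ))
    refine tendsto_natCast_atTop_iff.1 (h1.congr fun n => ?_)
    simp [hk]

/-- Reindexing an eventually periodic sequence by an integer-valued polynomial. -/
theorem EventuallyPeriodic.comp_polynomial {α : Type*} {a : ℕ → α} (ha : EventuallyPeriodic a)
    (q : Polynomial ℚ) (k : ℕ → ℕ) (hk : ∀ n : ℕ, q.eval (n : ℚ) = (k n : ℚ)) :
    EventuallyPeriodic (fun n => a (k n)) := by
  rcases polynomial_natValues_const_or_tendsto q k hk with hc | ht
  · exact ⟨1, one_pos, Eventually.of_forall fun n => by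
      show a (k (n + 1)) = a (k n)
      rw [hc (n + 1), hc n]⟩
  obtain ⟨d, hd, h⟩ := ha
  obtain ⟨s, hs⟩ := eventually_atTop.1 h
  have hmul : ∀ t n, s ≤ n → a (n + d * t) = a n := by
    intro t
    induction t with
    | zero => simp
    | succ t ih =>
      intro n hn
      rw [Nat.mul_succ, ← Nat.add_assoc, hs _ (by omega), ih n hn]
  have hmod : ∀ m n, s ≤ m → m ≤ n → n ≡ m [MOD d] → a n = a m := by
    intro m n hm hmn hc
    obtain ⟨t, ht⟩ := (Nat.modEq_iff_dvd' hmn).1 hc.symm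
    rw [show n = m + d * t by omega, hmul t m hm]
  obtain ⟨M, hM, hper⟩ := exists_period_modEq q k hk d hd
  refine ⟨M, hM, ?_⟩
  filter_upwards [ht.eventually_ge_atTop s,
    (ht.comp (tendsto_add_atTop_nat M)).eventually_ge_atTop s] with n h1 h2
  rcases le_total (k n) (k (n + M)) with hle | hle
  · exact hmod _ _ h1 hle (hper n)
  · exact (hmod _ _ h2 hle (hper n).symm).symm

/-- Fourier inversion on `ZMod M` expands `a` in the phases `j n / M`, of degree at most 1 in `n`.
-/
theorem IsOscillating.tendsto_periodic {d : ℕ} {c : ℕ → ℂ} (hc : IsOscillating d c)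
    (hd : 1 ≤ d) {M : ℕ} (hM : 0 < M) {a : ℕ → ℂ} (ha : Function.Periodic a M) :
    Tendsto (weightedMean c a) atTop (𝓝 0) := by
  have : NeZero M := ⟨hM.ne'⟩
  set Φ : ZMod M → ℂ := fun z => a z.val with hΦ
  have hexp : ∀ n : ℕ, a n = ∑ j : ZMod M, ((M : ℂ)⁻¹ * ZMod.dft Φ j) *
      Complex.exp (2 * (Real.pi : ℂ) * Complex.I *
        (((Polynomial.C ((j.val : ℝ) / M) * Polynomial.X).eval (n : ℝ) : ℝ) : ℂ)) := fun n => by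
    have h1 : a n = Φ (n : ZMod M) := by
      simp only [hΦ, ZMod.val_natCast]
      exact (ha.map_mod_nat n).symm
    rw [h1, ← ZMod.dft.symm_apply_apply Φ, ZMod.invDFT_apply, ZMod.dft.apply_symm_apply,
      smul_eq_mul, Finset.mul_sum]
    refine Finset.sum_congr rfl fun j _ => ?_
    have h2 : j * (n : ZMod M) = (((j.val * n : ℕ) : ℤ) : ZMod M) := by simp
    rw [h2, ZMod.stdAddChar_coe, smul_eq_mul]
    have h3 : 2 * (Real.pi : ℂ) * Complex.I * (((j.val * n : ℕ) : ℤ) : ℂ) / M =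
        2 * (Real.pi : ℂ) * Complex.I *
        (((Polynomial.C ((j.val : ℝ) / M) * Polynomial.X).eval (n : ℝ) : ℝ) : ℂ) := by
      simp only [Polynomial.eval_mul, Polynomial.eval_C, Polynomial.eval_X]
      push_cast
      ring
    rw [h3]
    ring
  have hsum : weightedMean c a = fun N : ℕ => ∑ j : ZMod M, ((M : ℂ)⁻¹ * ZMod.dft Φ j) *
      ((1 / (N : ℂ)) * ∑ n ∈ Finset.range N, c n * Complex.exp (2 * (Real.pi : ℂ) * Complex.I *
        (((Polynomial.C ((j.val : ℝ) / M) * Polynomial.X).eval (n : ℝ) : ℝ) : ℂ))) := by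
    funext N
    simp only [weightedMean, hexp, Finset.mul_sum]
    rw [Finset.sum_comm]
    refine Finset.sum_congr rfl fun j _ => Finset.sum_congr rfl fun n _ => ?_
    ring
  rw [hsum]
  have := tendsto_finsetSum (Finset.univ : Finset (ZMod M)) fun j _ =>
    (hc (Polynomial.C ((j.val : ℝ) / M) * Polynomial.X)
      (((Polynomial.natDegree_C_mul_le _ _).trans Polynomial.natDegree_X_le).trans hd)).const_mul ((M : ℂ)⁻¹ * ZMod.dft Φ j)
  simpa using this

theorem tendsto_weightedMean_of_eventuallyEq {c a b : ℕ → ℂ} (hab : a =ᶠ[atTop] b)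
    (hb : Tendsto (weightedMean c b) atTop (𝓝 0)) :
    Tendsto (weightedMean c a) atTop (𝓝 0) := by
  obtain ⟨s, hs⟩ := eventually_atTop.1 hab
  have h0 : Tendsto (fun N : ℕ => (1 / (N : ℂ)) * ∑ n ∈ Finset.range s, c n * (a n - b n))
      atTop (𝓝 0) := by
    simpa using (tendsto_one_div_atTop_nhds_zero_nat (𝕜 := ℂ)).mul_const
      (∑ n ∈ Finset.range s, c n * (a n - b n))
  have h := h0.add hb
  rw [add_zero] at h
  refine h.congr' ?_
  filter_upwards [eventually_ge_atTop s] with N hN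
  have h1 : ∑ n ∈ Finset.range s, c n * (a n - b n)
      = ∑ n ∈ Finset.range N, c n * (a n - b n) := by
    refine Finset.sum_subset (Finset.range_mono hN) fun n _ hn => ?_
    rw [hs n (by simpa using hn)]
    simp
  rw [h1, weightedMean, weightedMean, ← mul_add, ← Finset.sum_add_distrib]
  congr 1
  exact Finset.sum_congr rfl fun n _ => by ring

theorem IsOscillating.tendsto_eventuallyPeriodic {d : ℕ} {c : ℕ → ℂ} (hc : IsOscillating d c)
    (hd : 1 ≤ d) {a : ℕ → ℂ} (ha : EventuallyPeriodic a) :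
    Tendsto (weightedMean c a) atTop (𝓝 0) := by
  obtain ⟨M, hM, h⟩ := ha
  obtain ⟨t, ht⟩ := eventually_atTop.1 h
  -- The shift `M * t` is a multiple of the period and at least `t`, so the shifted sequence is
  -- periodic from index 0.
  have hle : ∀ n, t ≤ n + M * t := fun n => by nlinarith
  have hper : Function.Periodic (fun n => a (n + M * t)) M := fun n => by
    show a (n + M + M * t) = a (n + M * t)
    rw [add_right_comm]
    exact ht _ (hle n)
  refine tendsto_weightedMean_of_eventuallyEq ?_ (hc.tendsto_periodic hd hM hper)
  filter_upwards [eventually_add_mul_eq h t] with n hn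
  exact hn.symm

/-- If the means of `‖c n‖` are bounded, then sequences with vanishing means against `c` are closed
under uniform limits. -/
theorem tendsto_weightedMean_of_approx {c a : ℕ → ℂ} {B : ℝ}
    (hB : ∀ᶠ N : ℕ in atTop, ∑ n ∈ Finset.range N, ‖c n‖ ≤ B * N)
    (h : ∀ ε > 0, ∃ g : ℕ → ℂ, (∀ n, ‖a n - g n‖ ≤ ε) ∧ Tendsto (weightedMean c g) atTop (𝓝 0)) :
    Tendsto (weightedMean c a) atTop (𝓝 0) := by
  rw [Metric.tendsto_atTop']
  intro ε hε
  have hB' : 0 < |B| + 1 := by positivity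
  -- `|B| + 1` is positive whatever the sign of `B`.
  obtain ⟨g, hg, hlim⟩ := h (ε / 2 / (|B| + 1)) (by positivity)
  have h2 := (Metric.tendsto_nhds.1 hlim) (ε / 2) (by positivity)
  obtain ⟨s, hs⟩ := eventually_atTop.1 ((h2.and hB).and (eventually_gt_atTop 0))
  refine ⟨s, fun N hN => ?_⟩
  obtain ⟨⟨h3, h4⟩, hN0⟩ := hs N hN.le
  rw [dist_zero_right] at h3 ⊢
  have hNpos : (0 : ℝ) < N := by exact_mod_cast hN0
  have hsplit : weightedMean c a N = weightedMean c g N +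
      (1 / (N : ℂ)) * ∑ n ∈ Finset.range N, c n * (a n - g n) := by
    rw [weightedMean, weightedMean, ← mul_add, ← Finset.sum_add_distrib]
    congr 1
    exact Finset.sum_congr rfl fun n _ => by ring
  have h5 : ‖∑ n ∈ Finset.range N, c n * (a n - g n)‖ ≤ (ε / 2 / (|B| + 1)) * (B * N) := by
    refine (norm_sum_le _ _).trans (le_trans ?_ (mul_le_mul_of_nonneg_left h4 (by positivity)))
    rw [Finset.mul_sum]
    refine Finset.sum_le_sum fun n _ => ?_
    rw [norm_mul, mul_comm]
    exact mul_le_mul_of_nonneg_right (hg n) (norm_nonneg _)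
  have h6 : ‖(1 / (N : ℂ)) * ∑ n ∈ Finset.range N, c n * (a n - g n)‖ ≤ ε / 2 := by
    rw [norm_mul, norm_div, norm_one, Complex.norm_natCast]
    calc 1 / (N : ℝ) * ‖∑ n ∈ Finset.range N, c n * (a n - g n)‖
        ≤ 1 / (N : ℝ) * ((ε / 2 / (|B| + 1)) * (B * N)) :=
          mul_le_mul_of_nonneg_left h5 (by positivity)
      _ = ε / 2 * (B / (|B| + 1)) := by field_simp
      _ ≤ ε / 2 * 1 := by
          refine mul_le_mul_of_nonneg_left ?_ (by positivity)
          rw [div_le_one hB']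
          linarith [le_abs_self B]
      _ = ε / 2 := mul_one _
  rw [hsplit]
  linarith [norm_add_le (weightedMean c g N)
    ((1 / (N : ℂ)) * ∑ n ∈ Finset.range N, c n * (a n - g n))]

theorem exists_bound_sum_range_norm {c : ℕ → ℂ}
    (hcO : (fun N : ℕ => ∑ n ∈ Finset.Icc 1 N, ‖c n‖) =O[atTop] (fun N : ℕ => (N : ℝ))) :
    ∃ B : ℝ, ∀ᶠ N : ℕ in atTop, ∑ n ∈ Finset.range N, ‖c n‖ ≤ B * N := by
  obtain ⟨C, hC⟩ := hcO.bound
  -- The hypothesis omits the term `n = 0`; `‖c 0‖ ≤ ‖c 0‖ * N` absorbs it.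
  refine ⟨‖c 0‖ + C, ?_⟩
  filter_upwards [hC, eventually_ge_atTop 1] with N hN h1
  rw [Real.norm_of_nonneg (Finset.sum_nonneg fun _ _ => norm_nonneg _), Real.norm_natCast] at hN
  have hsub : Finset.range N ⊆ insert 0 (Finset.Icc 1 N) := fun n hn => by
    simp only [Finset.mem_range, Finset.mem_insert, Finset.mem_Icc] at hn ⊢
    omega
  have h2 := Finset.sum_le_sum_of_subset_of_nonneg (f := fun n => ‖c n‖) hsub
    fun _ _ _ => norm_nonneg _
  rw [Finset.sum_insert (by simp)] at h2
  have h3 : (1 : ℝ) ≤ N := by exact_mod_cast h1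
  nlinarith [norm_nonneg (c 0)]

section Padic

variable {p : ℕ} [Fact p.Prime]

/-- Polynomial evaluation commutes with reduction, so the orbit descends to the finite ring. -/
theorem eventuallyPeriodic_toZModPow_iterate (T : Polynomial ℤ_[p]) (x : ℤ_[p]) (m : ℕ) :
    EventuallyPeriodic
      (fun n => PadicInt.toZModPow m ((fun y : ℤ_[p] => T.eval y)^[n] x)) := by
  have : NeZero (p ^ m) := ⟨pow_ne_zero _ (Fact.out : p.Prime).ne_zero⟩
  have hsemi : Function.Semiconj (PadicInt.toZModPow m : ℤ_[p] → ZMod (p ^ m))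
      (fun y => T.eval y) (fun y => (T.map (PadicInt.toZModPow m)).eval y) := fun y => by
    show PadicInt.toZModPow m (T.eval y) = (T.map (PadicInt.toZModPow m)).eval _
    rw [Polynomial.eval_map, Polynomial.eval₂_at_apply]
  have h := eventuallyPeriodic_iterate
    (fun y => (T.map (PadicInt.toZModPow m)).eval y) (PadicInt.toZModPow m x)
  have heq : (fun n => PadicInt.toZModPow m ((fun y : ℤ_[p] => T.eval y)^[n] x)) =
      fun n => (fun y => (T.map (PadicInt.toZModPow m)).eval y)^[n] (PadicInt.toZModPow m x) :=
    funext fun n => hsemi.iterate_right n x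
  rw [heq]
  exact h

theorem dist_val_toZModPow_le (y : ℤ_[p]) (m : ℕ) :
    dist y (((PadicInt.toZModPow m y).val : ℕ) : ℤ_[p]) ≤ (p : ℝ) ^ (-m : ℤ) := by
  have : NeZero (p ^ m) := ⟨pow_ne_zero _ (Fact.out : p.Prime).ne_zero⟩
  rw [dist_eq_norm, PadicInt.norm_le_pow_iff_mem_span_pow, ← PadicInt.ker_toZModPow,
    RingHom.mem_ker, map_sub, map_natCast, ZMod.natCast_zmod_val, sub_self]

/-- A continuous function on `ℤ_[p] ^ ι` is uniformly close to one factoring through a finite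
quotient. -/
theorem exists_approx_toZModPow {ι : Type*} [Fintype ι] (F : C(ι → ℤ_[p], ℂ)) {ε : ℝ}
    (hε : 0 < ε) : ∃ (m : ℕ) (G : (ι → ZMod (p ^ m)) → ℂ),
      ∀ y : ι → ℤ_[p], ‖F y - G (fun i => PadicInt.toZModPow m (y i))‖ ≤ ε := by
  obtain ⟨δ, hδ, hF⟩ := Metric.uniformContinuous_iff.1
    (CompactSpace.uniformContinuous_of_continuous F.continuous) ε hε
  obtain ⟨m, hm⟩ := PadicInt.exists_pow_neg_lt p hδ
  refine ⟨m, fun v => F fun i => (((v i).val : ℕ) : ℤ_[p]), fun y => ?_⟩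
  rw [← dist_eq_norm]
  exact (hF ((dist_pi_lt_iff hδ).2 fun i => (dist_val_toZModPow_le (y i) m).trans_lt hm)).le

end Padic

theorem corollary2 (p : ℕ) [Fact p.Prime] (T : Polynomial ℤ_[p])
    (ℓ : ℕ) (hℓ : 1 ≤ ℓ) (q : Fin ℓ → Polynomial ℚ)
    -- each `q j` takes values in `ℕ` at the integers `n ≥ 0`; `k j n` is the natural number `q j (n)`
    (k : Fin ℓ → ℕ → ℕ) (hk : ∀ (j : Fin ℓ) (n : ℕ), (q j).eval (n : ℚ) = (k j n : ℚ))
    (Δ : ℕ) (hΔ : Δ = Finset.univ.sup (fun j : Fin ℓ => (q j).natDegree))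
    (c : ℕ → ℂ) (hc : IsOscillating Δ c)
    (hcO : (fun N : ℕ => ∑ n ∈ Finset.Icc 1 N, ‖c n‖) =O[atTop] (fun N : ℕ => (N : ℝ)))
    (F : C(Fin ℓ → ℤ_[p], ℂ)) (x : ℤ_[p]) :
    Tendsto (fun N : ℕ => (1 / (N : ℂ)) *
      ∑ n ∈ Finset.range N, c n * F (fun j : Fin ℓ => (fun y : ℤ_[p] => T.eval y)^[k j n] x))
      atTop (𝓝 0) := by
  rcases Nat.eq_zero_or_pos Δ with h0 | hpos
  · have hconst : ∀ j n, k j n = k j 0 := fun j n => by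
      have hdeg : (q j).natDegree = 0 := Nat.le_zero.1 <| by
        rw [← h0, hΔ]
        exact Finset.le_sup (f := fun j : Fin ℓ => (q j).natDegree) (Finset.mem_univ j)
      have h := hk j n
      rw [Polynomial.eq_C_of_natDegree_eq_zero hdeg, Polynomial.eval_C] at h
      have h' := hk j 0
      rw [Polynomial.eq_C_of_natDegree_eq_zero hdeg, Polynomial.eval_C, h] at h'
      exact_mod_cast h'
    have h := (hc 0 (by simp)).mul_const
      (F (fun j : Fin ℓ => (fun y : ℤ_[p] => T.eval y)^[k j 0] x))
    rw [zero_mul] at h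
    refine h.congr fun N => ?_
    simp only [hconst _ _, Polynomial.eval_zero, Complex.ofReal_zero, mul_zero, Complex.exp_zero,
      mul_one, mul_assoc, Finset.sum_mul]
  · obtain ⟨B, hB⟩ := exists_bound_sum_range_norm hcO
    refine tendsto_weightedMean_of_approx hB fun ε hε => ?_
    obtain ⟨m, G, hG⟩ := exists_approx_toZModPow F hε
    refine ⟨_, fun n => hG _, hc.tendsto_eventuallyPeriodic hpos ?_⟩
    exact (EventuallyPeriodic.pi fun j =>
      (eventuallyPeriodic_toZModPow_iterate T x m).comp_polynomial (q j) (k j) (hk j)).comp G
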